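/- Let $\mathcal C\subset\mathbb R^d$ be a nonempty compact convex set and let $\mathcal F$ be the class of all Lipschitz convex functions $f:\mathcal C\to\mathbb R$ (with no common bound on the Lipschitz constants). For $f\in\mathcal F$ let $\mathcal X_f^*=\arg\min_{x\in\mathcal C}f(x)$ and $\partial f(x)=\{z\in\mathbb R^d: f(y)\ge f(x)+\langle z,y-x\rangle\ \forall y\in\mathcal C\}$. Fix any deterministic rule that assigns to every $f\in\mathcal F$ and $x\in\mathcal C$ a subgradient $f'(x)\in\partial f(x)$, Borel measurable in $x$, and fix $\sigma>0$. When queried at $x\in\mathcal C$, the stochastic first-order oracle for $f$ returns $f'(x)+\xi$ with $\xi\sim N(0,\sigma^2I_d)$, the noise being independent across queries. Let $\mathcal A_T$ be the set of all (possibly randomized) algorithms that make $T$ queries: an algorithm may draw a random seed independent of the noise, each query point in $\mathcal C$ is a measurable function of the seed and the previous answers, and the output $\hat x_A\in\mathcal C$ is a measurable function of the seed and all answers. Let $\mathbb E_f$ denote expectation when the oracle answers for $f$. Put $$\mathrm{err}(x,f)=\inf_{y\in\mathcal X_f^*}\|x-y\|,\qquad R_T(f;\mathcal F)=\sup_{g\in\mathcal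 F}\ \inf_{A\in\mathcal A_T}\ \max_{h\in\{f,g\}}\mathbb E_h\,\mathrm{err}(\hat x_A,h),$$ $$d(f,g)=\inf_{x\in\mathcal X_f^*,\,y\in\mathcal X_g^*}\|x-y\|,\quad \kappa(f,g)=\sup_{x\in\mathcal C}\|f'(x)-g'(x)\|\in[0,\infty],\quad \omega_f(\epsilon)=\sup\{d(f,g): g\in\mathcal F,\ \kappa(f,g)\le\epsilon\}.$$ Let $f\in\mathcal F$. Suppose that $\omega_f$ has polynomial growth, that is, there are $\alpha>0$ and $\epsilon_0>0$ such that $\omega_f(c\epsilon)\le c^\alpha\,\omega_f(\epsilon)$ for all $c\ge1$ and $0<\epsilon\le\epsilon_0/c$; and suppose that $\omega_f$ does not vanish near $0$, that is, $\omega_f(\epsilon)>0$ for all $\epsilon>0$. Then there exist constants $C_1,C_2>0$, independent of $T$, and $T_0>0$ such that for all integers $T>T_0$ $$C_1\,\omega_f\!\left(\frac{\sigma}{\sqrt T}\right)\le R_T(f;\mathcal F)\le C_2\,\omega_f\!\left(\frac{\sigma}{\sqrt T}\right).$$ -/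

import Mathlib

open MeasureTheory ProbabilityTheory
open scoped ENNReal NNReal

/-- `LipConvex C` is the class of Lipschitz convex real functions on the domain `C`
(with no common bound on the Lipschitz constants). -/
structure LipConvex {d : ℕ} (C : Set (EuclideanSpace ℝ (Fin d))) where
  toFun : C → ℝ
  lipschitz : ∃ K : ℝ≥0, LipschitzWith K toFun
  convex : ∀ (x y z : C) (a b : ℝ), 0 ≤ a → 0 ≤ b → a + b = 1 →
    (z : EuclideanSpace ℝ (Fin d)) = a • (x : EuclideanSpace ℝ (Fin d)) + b • (y : EuclideanSpace ℝ (Fin d)) →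
    toFun z ≤ a * toFun x + b * toFun y

/-- The subdifferential of `f` at `x`, for `f` a function on the domain `C`. -/
def LipConvex.subdifferential {d : ℕ} {C : Set (EuclideanSpace ℝ (Fin d))}
    (f : LipConvex C) (x : C) : Set (EuclideanSpace ℝ (Fin d)) :=
  {z | ∀ y : C, f.toFun x +
    inner ℝ z ((y : EuclideanSpace ℝ (Fin d)) - (x : EuclideanSpace ℝ (Fin d))) ≤ f.toFun y}

/-- The set of minimum points of `f` over `C`. -/
def LipConvex.argmin {d : ℕ} {C : Set (EuclideanSpace ℝ (Fin d))}
    (f : LipConvex C) : Set C :=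
  {x | ∀ y : C, f.toFun x ≤ f.toFun y}

/-- A deterministic mechanism that picks, for each function `f` of the class and each point `x` of
the domain, one subgradient `f'(x)` of `f` at `x`: the mean of the answer of the stochastic oracle
to the query `x`. The choice is Borel in `x`, so that the answers are random vectors. -/
structure SubgradientChoice {d : ℕ} (C : Set (EuclideanSpace ℝ (Fin d))) where
  grad : LipConvex C → C → EuclideanSpace ℝ (Fin d)
  grad_mem : ∀ (f : LipConvex C) (x : C), grad f x ∈ f.subdifferential x
  measurable_grad : ∀ f : LipConvex C, Measurable (grad f)

/-- The Gaussian law `N(0, σ² I_d)`: the law of `σ Z` with `Z` standard Gaussian. -/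
noncomputable def oracleNoise (d : ℕ) (σ : ℝ) : Measure (EuclideanSpace ℝ (Fin d)) :=
  (stdGaussian (EuclideanSpace ℝ (Fin d))).map (fun z => σ • z)

/-- A (randomized) algorithm that makes `T` sequential queries: it draws a seed, its `t`-th query
point is a measurable function of the seed and of the preceding answers, and its output is a
measurable function of the seed and of all `T` answers. -/
structure QueryAlgorithm {d : ℕ} (C : Set (EuclideanSpace ℝ (Fin d))) (T : ℕ) where
  Seed : Type
  seedMeasurableSpace : MeasurableSpace Seed
  seedLaw : Measure Seed
  seedLaw_prob : IsProbabilityMeasure seedLaw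
  query : (t : Fin T) → Seed × (Fin t → EuclideanSpace ℝ (Fin d)) → C
  measurable_query : ∀ t, Measurable (query t)
  output : Seed × (Fin T → EuclideanSpace ℝ (Fin d)) → C
  measurable_output : Measurable output

attribute [instance] QueryAlgorithm.seedMeasurableSpace QueryAlgorithm.seedLaw_prob

/-- The first `n` answers `v_t = f'(x_t) + ξ_t` received by the algorithm, when the seed is `s`, the
oracle has the mean map `f'` (the argument `G`) and the realized noise vectors are `ξ_t`. -/
def QueryAlgorithm.answers {d : ℕ} {C : Set (EuclideanSpace ℝ (Fin d))} {T : ℕ}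
    (A : QueryAlgorithm C T) (G : C → EuclideanSpace ℝ (Fin d)) (s : A.Seed)
    (ξ : Fin T → EuclideanSpace ℝ (Fin d)) :
    (n : ℕ) → n ≤ T → (Fin n → EuclideanSpace ℝ (Fin d))
  | 0, _ => Fin.elim0
  | n + 1, h =>
    let v := A.answers G s ξ n (Nat.le_of_succ_le h)
    Fin.snoc (α := fun _ => EuclideanSpace ℝ (Fin d)) v (G (A.query ⟨n, h⟩ (s, v)) + ξ ⟨n, h⟩)

/-- `err(x, f)`: the distance from `x` to the set of minimum points of `f`. -/
noncomputable def LipConvex.err {d : ℕ} {C : Set (EuclideanSpace ℝ (Fin d))}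
    (f : LipConvex C) (x : C) : ℝ≥0∞ :=
  ⨅ y ∈ f.argmin, edist x y

/-- `E_f err(x̂_A, f)`: the expected error on `f`, over the seed of the algorithm and `T` independent
Gaussian noise vectors of law `N(0, σ² I_d)`. -/
noncomputable def expectedErr {d : ℕ} {C : Set (EuclideanSpace ℝ (Fin d))}
    (O : SubgradientChoice C) (σ : ℝ) {T : ℕ} (A : QueryAlgorithm C T) (f : LipConvex C) : ℝ≥0∞ :=
  ∫⁻ p : A.Seed × (Fin T → EuclideanSpace ℝ (Fin d)),
    f.err (A.output (p.1, A.answers (O.grad f) p.1 p.2 T le_rfl))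
    ∂(A.seedLaw.prod (Measure.pi fun _ : Fin T => oracleNoise d σ))

/-- The local minimax complexity `R_T(f; F)`. -/
noncomputable def localMinimax {d : ℕ} {C : Set (EuclideanSpace ℝ (Fin d))}
    (O : SubgradientChoice C) (σ : ℝ) (T : ℕ) (f : LipConvex C) : ℝ≥0∞ :=
  ⨆ g : LipConvex C, ⨅ A : QueryAlgorithm C T, max (expectedErr O σ A f) (expectedErr O σ A g)

/-- `d(f, g)`: the distance between the sets of minimum points of `f` and `g`. -/
noncomputable def argminDist {d : ℕ} {C : Set (EuclideanSpace ℝ (Fin d))}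
    (f g : LipConvex C) : ℝ≥0∞ :=
  ⨅ x ∈ f.argmin, ⨅ y ∈ g.argmin, edist x y

/-- `κ(f, g) = sup_x ‖f'(x) - g'(x)‖`, which may be infinite. -/
noncomputable def gradGap {d : ℕ} {C : Set (EuclideanSpace ℝ (Fin d))}
    (O : SubgradientChoice C) (f g : LipConvex C) : ℝ≥0∞ :=
  ⨆ x : C, edist (O.grad f x) (O.grad g x)

/-- The computational modulus of continuity `ω_f(ε) = sup {d(f, g) : κ(f, g) ≤ ε}`. -/
noncomputable def modulus {d : ℕ} {C : Set (EuclideanSpace ℝ (Fin d))}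
    (O : SubgradientChoice C) (f : LipConvex C) (ε : ℝ) : ℝ≥0∞ :=
  ⨆ (g : LipConvex C) (_ : gradGap O f g ≤ ENNReal.ofReal ε), argminDist f g

/-- Polynomial growth of a modulus `ω`: for some `α > 0` and `ε₀ > 0`, `ω(c ε) ≤ c ^ α ω(ε)` for all
`c ≥ 1` and `0 < ε ≤ ε₀ / c`. -/
def PolynomialGrowth (ω : ℝ → ℝ≥0∞) : Prop :=
  ∃ α ε₀ : ℝ, 0 < α ∧ 0 < ε₀ ∧ ∀ c ε : ℝ, 1 ≤ c → 0 < ε → ε ≤ ε₀ / c →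
    ω (c * ε) ≤ ENNReal.ofReal (c ^ α) * ω ε

/-! Since the algorithm is chosen after `g`, the problem is a test between two known functions.

Lower bound: if the gradients of `f` and `g` differ by at most `σ / √T` everywhere, each answer
multiplies the chi-square factor between the two transcript laws by at most `exp (1 / T)`, so `T`
adaptive answers cost at most `e` (`sq_lintegral_answers_le`). No output is within `d(f, g) / 2` of
both argmin sets, so confusing the laws forces an error of order `d(f, g)`
(`argminDist_le_max_expectedErr`). This needs no growth assumption.

Upper bound: query only one point where the gradients nearly realize their gap, and run a likelihood
ratio test whose two outputs are a closest pair of minimizers. The error is at most `d(f, g) * exp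
(-T * ‖m‖ ^ 2 / (8 * σ ^ 2))`, with `m` the gradient difference there (`iInf_max_expectedErr_le`).
With `t` the gap, truncated at `ε₀`, in units of `σ / √T`, polynomial growth bounds `d(f, g)` by a
multiple of `t ^ α * ω_f(σ / √T)`, and the Gaussian factor absorbs `t ^ α`. -/

/-! ### Gaussian change of mean and its chi-square cost. -/

theorem sq_lintegral_mul_le {α : Type*} [MeasurableSpace α] (μ : Measure α) {f g : α → ℝ≥0∞}
    (hf : AEMeasurable f μ) (hg : AEMeasurable g μ) :
    (∫⁻ a, f a * g a ∂μ) ^ 2 ≤ (∫⁻ a, f a ^ 2 ∂μ) * ∫⁻ a, g a ^ 2 ∂μ := by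
  have h := ENNReal.lintegral_mul_le_Lp_mul_Lq μ Real.HolderConjugate.two_two hf hg
  have hs : ∀ x : ℝ≥0∞, (x ^ (1 / (2 : ℝ))) ^ 2 = x := fun x => by
    rw [← ENNReal.rpow_two, ← ENNReal.rpow_mul]; norm_num
  calc (∫⁻ a, f a * g a ∂μ) ^ 2
      ≤ ((∫⁻ a, f a ^ (2 : ℝ) ∂μ) ^ (1 / (2 : ℝ)) * (∫⁻ a, g a ^ (2 : ℝ) ∂μ) ^ (1 / (2 : ℝ))) ^ 2 :=
        pow_le_pow_left' h 2
    _ = _ := by simp_rw [mul_pow, hs, ENNReal.rpow_two]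

theorem lintegral_pi_prod_eq_prod {ι : Type*} [Fintype ι] {α : ι → Type*}
    [∀ i, MeasurableSpace (α i)] (μ : ∀ i, Measure (α i)) [∀ i, IsProbabilityMeasure (μ i)]
    {f : ∀ i, α i → ℝ≥0∞} (hf : ∀ i, Measurable (f i)) :
    ∫⁻ x, ∏ i, f i (x i) ∂(Measure.pi μ) = ∏ i, ∫⁻ x, f i x ∂(μ i) := by
  have hind := iIndepFun_pi (μ := μ) (X := f) (fun i => (hf i).aemeasurable)
  have h := lintegral_prod_eq_prod_lintegral_of_indepFun Finset.univ
    (fun i (x : ∀ i, α i) => f i (x i)) hind (fun i => (hf i).comp (measurable_pi_apply i))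
  rw [h]
  refine Finset.prod_congr rfl fun i _ => ?_
  exact (measurePreserving_eval μ i).lintegral_comp (hf i)

theorem pi_withDensity {ι : Type*} [Fintype ι] {α : ι → Type*}
    [∀ i, MeasurableSpace (α i)] (μ : ∀ i, Measure (α i)) [∀ i, IsProbabilityMeasure (μ i)]
    {f : ∀ i, α i → ℝ≥0∞} (hf : ∀ i, Measurable (f i))
    [∀ i, SigmaFinite ((μ i).withDensity (f i))] :
    Measure.pi (fun i => (μ i).withDensity (f i)) =
      (Measure.pi μ).withDensity (fun x => ∏ i, f i (x i)) := by
  refine Measure.pi_eq fun s hs => ?_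
  rw [withDensity_apply _ (MeasurableSet.univ_pi hs), ← lintegral_indicator (MeasurableSet.univ_pi hs)]
  have h : ∀ x : ∀ i, α i, (Set.univ.pi s).indicator (fun x => ∏ i, f i (x i)) x =
      ∏ i, (s i).indicator (f i) (x i) := by
    intro x
    by_cases hx : x ∈ Set.univ.pi s
    · rw [Set.indicator_of_mem hx]
      exact Finset.prod_congr rfl fun i _ => (Set.indicator_of_mem (hx i trivial) _).symm
    · rw [Set.indicator_of_notMem hx]
      simp only [Set.mem_univ_pi, not_forall] at hx
      obtain ⟨i, hi⟩ := hx
      exact (Finset.prod_eq_zero (Finset.mem_univ i) (Set.indicator_of_notMem hi _)).symm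
  simp_rw [h]
  rw [lintegral_pi_prod_eq_prod μ (fun i => (hf i).indicator (hs i))]
  refine Finset.prod_congr rfl fun i _ => ?_
  rw [lintegral_indicator (hs i), withDensity_apply _ (hs i)]

theorem gaussianReal_eq_withDensity (m : ℝ) :
    gaussianReal m 1 =
      (gaussianReal 0 1).withDensity (fun x => ENNReal.ofReal (Real.exp (m * x - m ^ 2 / 2))) := by
  rw [gaussianReal_of_var_ne_zero _ one_ne_zero, gaussianReal_of_var_ne_zero _ one_ne_zero,
    ← withDensity_mul _ (measurable_gaussianPDF 0 1) (by fun_prop)]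
  congr 1
  ext x
  simp only [gaussianPDF, gaussianPDFReal, Pi.mul_apply]
  rw [← ENNReal.ofReal_mul (by positivity), mul_assoc (_⁻¹), ← Real.exp_add]
  congr 3
  simp only [NNReal.coe_one]
  ring

/-- Cameron–Martin formula: the one-dimensional densities multiply over the coordinates. -/
theorem lintegral_add_stdGaussian {d : ℕ} (m : EuclideanSpace ℝ (Fin d))
    {φ : EuclideanSpace ℝ (Fin d) → ℝ≥0∞} (hφ : Measurable φ) :
    ∫⁻ z, φ (z + m) ∂(stdGaussian (EuclideanSpace ℝ (Fin d))) =
      ∫⁻ z, φ z * ENNReal.ofReal (Real.exp (inner ℝ m z - ‖m‖ ^ 2 / 2))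
        ∂(stdGaussian (EuclideanSpace ℝ (Fin d))) := by
  have hL : Measurable (WithLp.toLp 2 : (Fin d → ℝ) → EuclideanSpace ℝ (Fin d)) := by fun_prop
  have hshift : Measure.pi (fun i : Fin d => gaussianReal (m i) 1) =
      (Measure.pi (fun _ : Fin d => gaussianReal 0 1)).map (fun x i => x i + m i) := by
    have h := Measure.pi_map_pi (μ := fun _ : Fin d => gaussianReal 0 1)
      (f := fun i x => x + m i) (fun i => by fun_prop)
    rw [h]
    simp [gaussianReal_map_add_const]
  have hdens : Measure.pi (fun i : Fin d => gaussianReal (m i) 1) =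
      (Measure.pi (fun _ : Fin d => gaussianReal 0 1)).withDensity
        (fun x => ∏ i, ENNReal.ofReal (Real.exp (m i * x i - m i ^ 2 / 2))) := by
    have : ∀ i, SigmaFinite ((gaussianReal 0 1).withDensity
        (fun x => ENNReal.ofReal (Real.exp (m i * x - m i ^ 2 / 2)))) := fun i => by
      rw [← gaussianReal_eq_withDensity]; infer_instance
    rw [← pi_withDensity _ (f := fun i x => ENNReal.ofReal (Real.exp (m i * x - m i ^ 2 / 2)))
      (fun i => by fun_prop)]
    simp_rw [← gaussianReal_eq_withDensity]
  rw [← map_pi_eq_stdGaussian, lintegral_map (by fun_prop) hL, lintegral_map (by fun_prop) hL]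
  calc ∫⁻ x, φ (WithLp.toLp 2 x + m) ∂(Measure.pi fun _ : Fin d => gaussianReal 0 1)
      = ∫⁻ x, φ (WithLp.toLp 2 x) ∂(Measure.pi fun i : Fin d => gaussianReal (m i) 1) := by
        rw [hshift, lintegral_map (by fun_prop) (by fun_prop)]
        rfl
    _ = _ := by
        rw [hdens, lintegral_withDensity_eq_lintegral_mul _ (by fun_prop) (by fun_prop)]
        refine lintegral_congr fun x => ?_
        rw [Pi.mul_apply, mul_comm, ← ENNReal.ofReal_prod_of_nonneg (fun i _ => by positivity),
          ← Real.exp_sum, Finset.sum_sub_distrib, EuclideanSpace.real_norm_sq_eq, PiLp.inner_apply,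
          Finset.sum_div]
        simp [mul_comm]

theorem map_inner_stdGaussian {d : ℕ} (m : EuclideanSpace ℝ (Fin d)) :
    (stdGaussian (EuclideanSpace ℝ (Fin d))).map (fun z => inner ℝ m z) =
      gaussianReal 0 (‖m‖ ^ 2).toNNReal := by
  have h := IsGaussian.map_eq_gaussianReal (μ := stdGaussian (EuclideanSpace ℝ (Fin d)))
    (innerSL ℝ m)
  rw [integral_strongDual_stdGaussian, variance_dual_stdGaussian, innerSL_apply_norm] at h
  exact h

theorem lintegral_exp_inner_stdGaussian {d : ℕ} (m : EuclideanSpace ℝ (Fin d)) :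
    ∫⁻ z, ENNReal.ofReal (Real.exp (inner ℝ m z)) ∂(stdGaussian (EuclideanSpace ℝ (Fin d))) =
      ENNReal.ofReal (Real.exp (‖m‖ ^ 2 / 2)) := by
  have h : ∫⁻ x, ENNReal.ofReal (Real.exp x) ∂(gaussianReal 0 (‖m‖ ^ 2).toNNReal) =
      ENNReal.ofReal (Real.exp (‖m‖ ^ 2 / 2)) := by
    have hi := integrable_exp_mul_gaussianReal (μ := 0) (v := (‖m‖ ^ 2).toNNReal) 1
    simp only [one_mul] at hi
    rw [← ofReal_integral_eq_lintegral_ofReal hi (ae_of_all _ fun _ => by positivity)]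
    have := congrFun (mgf_id_gaussianReal (μ := 0) (v := (‖m‖ ^ 2).toNNReal)) 1
    simp only [mgf, id, one_mul] at this
    rw [this, Real.coe_toNNReal _ (by positivity)]
    simp
  rw [← h, ← map_inner_stdGaussian, lintegral_map (by fun_prop) (by fun_prop)]

/-- Cauchy–Schwarz against the density of the shifted Gaussian, whose second moment is `exp (-‖m‖ ^
2) * exp (2 * ‖m‖ ^ 2)` for the normalized shift `m`. -/
theorem sq_lintegral_add_oracleNoise_le {d : ℕ} {σ : ℝ} (hσ : 0 < σ)
    (a b : EuclideanSpace ℝ (Fin d)) {φ : EuclideanSpace ℝ (Fin d) → ℝ≥0∞} (hφ : Measurable φ) :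
    (∫⁻ y, φ (a + y) ∂(oracleNoise d σ)) ^ 2 ≤
      ENNReal.ofReal (Real.exp (‖a - b‖ ^ 2 / σ ^ 2)) *
        ∫⁻ y, φ (b + y) ^ 2 ∂(oracleNoise d σ) := by
  set m : EuclideanSpace ℝ (Fin d) := σ⁻¹ • (a - b) with hm
  have hmn : ‖m‖ ^ 2 = ‖a - b‖ ^ 2 / σ ^ 2 := by
    rw [hm, norm_smul, mul_pow, norm_inv, Real.norm_of_nonneg hσ.le]; field_simp
  have hsm : Measurable (fun z : EuclideanSpace ℝ (Fin d) => σ • z) := by fun_prop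
  rw [oracleNoise, lintegral_map (by fun_prop) hsm, lintegral_map (by fun_prop) hsm]
  have h1 : ∀ z, φ (a + σ • z) = φ (b + σ • (z + m)) := fun z => by
    rw [hm, smul_add, smul_smul, mul_inv_cancel₀ hσ.ne', one_smul]; congr 1; abel
  clear_value m
  simp_rw [h1]
  rw [lintegral_add_stdGaussian m (φ := fun z => φ (b + σ • z)) (by fun_prop)]
  refine (sq_lintegral_mul_le _ (by fun_prop) (by fun_prop)).trans_eq ?_
  rw [mul_comm]
  congr 1
  have h2 : ∀ z : EuclideanSpace ℝ (Fin d),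
      ENNReal.ofReal (Real.exp (inner ℝ m z - ‖m‖ ^ 2 / 2)) ^ 2 =
        ENNReal.ofReal (Real.exp (-‖m‖ ^ 2)) *
          ENNReal.ofReal (Real.exp (inner ℝ ((2 : ℝ) • m) z)) := fun z => by
    rw [← ENNReal.ofReal_pow (by positivity), ← ENNReal.ofReal_mul (by positivity),
      ← Real.exp_add, ← Real.exp_nat_mul, real_inner_smul_left]
    congr 2
    push_cast
    ring
  simp_rw [h2]
  rw [lintegral_const_mul _ (by fun_prop), lintegral_exp_inner_stdGaussian,
    ← ENNReal.ofReal_mul (by positivity), ← Real.exp_add, norm_smul, ← hmn]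
  congr 2
  norm_num
  ring

instance isProbabilityMeasure_oracleNoise (d : ℕ) (σ : ℝ) :
    IsProbabilityMeasure (oracleNoise d σ) :=
  Measure.isProbabilityMeasure_map (Measurable.aemeasurable (by fun_prop))

/-! ### Laws of adaptive transcripts. -/

theorem lintegral_pi_update {ι : Type*} [Fintype ι] [DecidableEq ι] {α : ι → Type*}
    [∀ i, MeasurableSpace (α i)] (μ : ∀ i, Measure (α i)) [∀ i, IsProbabilityMeasure (μ i)]
    (i : ι) {F : (∀ i, α i) → ℝ≥0∞} (hF : Measurable F) :
    ∫⁻ x, ∫⁻ y, F (Function.update x i y) ∂(μ i) ∂(Measure.pi μ) = ∫⁻ x, F x ∂(Measure.pi μ) := by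
  have hu : Measurable (fun p : (∀ i, α i) × α i => Function.update p.1 i p.2) :=
    measurable_update'
  refine lintegral_eq_of_lmarginal_eq {i} ?_ hF ?_
  · exact (hF.comp hu).lintegral_prod_right'
  · ext x
    simp [lmarginal_singleton]

theorem Measurable.finSnoc {Ω E : Type*} [MeasurableSpace Ω] [MeasurableSpace E] {n : ℕ}
    {v : Ω → Fin n → E} {y : Ω → E} (hv : Measurable v) (hy : Measurable y) :
    Measurable (fun ω => (Fin.snoc (v ω) (y ω) : Fin (n + 1) → E)) := by
  refine measurable_pi_lambda _ fun i => ?_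
  refine Fin.lastCases ?_ (fun j => ?_) i
  · simpa using hy
  · simpa using measurable_pi_iff.1 hv j

namespace QueryAlgorithm

variable {d : ℕ} {C : Set (EuclideanSpace ℝ (Fin d))} {T : ℕ} (A : QueryAlgorithm C T)

theorem measurable_answers {G : C → EuclideanSpace ℝ (Fin d)} (hG : Measurable G) (n : ℕ)
    (h : n ≤ T) :
    Measurable (fun p : A.Seed × (Fin T → EuclideanSpace ℝ (Fin d)) =>
      A.answers G p.1 p.2 n h) := by
  induction n with
  | zero => exact measurable_const (a := Fin.elim0)
  | succ n ih =>
    have hv := ih (Nat.le_of_succ_le h)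
    exact hv.finSnoc ((hG.comp ((A.measurable_query ⟨n, h⟩).comp (measurable_fst.prodMk hv))).add
      ((measurable_pi_apply _).comp measurable_snd))

theorem answers_update (G : C → EuclideanSpace ℝ (Fin d)) (s : A.Seed)
    (ξ : Fin T → EuclideanSpace ℝ (Fin d)) (m : Fin T) (y : EuclideanSpace ℝ (Fin d)) (n : ℕ)
    (h : n ≤ T) (hnm : n ≤ m) :
    A.answers G s (Function.update ξ m y) n h = A.answers G s ξ n h := by
  induction n with
  | zero => rfl
  | succ n ih =>
    have hne : (⟨n, h⟩ : Fin T) ≠ m := fun hm => by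
      have := congrArg Fin.val hm
      simp only at this
      omega
    simp only [answers, ih (Nat.le_of_succ_le h) (by omega), Function.update_of_ne hne]

/-- The law of the seed and the noise. -/
noncomputable def noiseLaw (σ : ℝ) :
    Measure (A.Seed × (Fin T → EuclideanSpace ℝ (Fin d))) :=
  A.seedLaw.prod (Measure.pi fun _ : Fin T => oracleNoise d σ)

instance (σ : ℝ) : IsProbabilityMeasure (A.noiseLaw σ) := by
  unfold noiseLaw; infer_instance

/-- Conditioning on the seed and the first `n` answers: these do not involve the noise of query `n`,
which can therefore be resampled independently. -/
theorem lintegral_answers_succ {G : C → EuclideanSpace ℝ (Fin d)} (hG : Measurable G) (σ : ℝ)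
    (n : ℕ) (h : n + 1 ≤ T)
    {φ : A.Seed × (Fin (n + 1) → EuclideanSpace ℝ (Fin d)) → ℝ≥0∞} (hφ : Measurable φ) :
    ∫⁻ p, φ (p.1, A.answers G p.1 p.2 (n + 1) h) ∂(A.noiseLaw σ) =
      ∫⁻ p, (fun q : A.Seed × (Fin n → EuclideanSpace ℝ (Fin d)) =>
        ∫⁻ y, φ (q.1, Fin.snoc q.2 (G (A.query ⟨n, h⟩ q) + y)) ∂(oracleNoise d σ))
          (p.1, A.answers G p.1 p.2 n (Nat.le_of_succ_le h)) ∂(A.noiseLaw σ) := by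
  have hv := A.measurable_answers hG n (Nat.le_of_succ_le h)
  have hF : Measurable fun p : A.Seed × (Fin T → EuclideanSpace ℝ (Fin d)) =>
      φ (p.1, A.answers G p.1 p.2 (n + 1) h) :=
    hφ.comp (measurable_fst.prodMk (A.measurable_answers hG (n + 1) h))
  have hmean : Measurable fun q : A.Seed × (Fin n → EuclideanSpace ℝ (Fin d)) =>
      ∫⁻ y, φ (q.1, Fin.snoc q.2 (G (A.query ⟨n, h⟩ q) + y)) ∂(oracleNoise d σ) := by
    refine Measurable.lintegral_prod_right' (f := fun r : (A.Seed × (Fin n → EuclideanSpace ℝ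
      (Fin d))) × EuclideanSpace ℝ (Fin d) =>
        φ (r.1.1, Fin.snoc r.1.2 (G (A.query ⟨n, h⟩ r.1) + r.2))) ?_
    refine hφ.comp ((measurable_fst.comp measurable_fst).prodMk
      ((measurable_snd.comp measurable_fst).finSnoc (Measurable.add ?_ measurable_snd)))
    exact hG.comp ((A.measurable_query _).comp measurable_fst)
  rw [noiseLaw, lintegral_prod _ hF.aemeasurable]
  refine Eq.trans (lintegral_congr fun s => ?_)
    (lintegral_prod _ (hmean.comp (measurable_fst.prodMk hv)).aemeasurable).symm
  rw [← lintegral_pi_update (fun _ : Fin T => oracleNoise d σ) ⟨n, h⟩ (F := fun ξ =>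
    φ (s, A.answers G s ξ (n + 1) h)) (hF.comp measurable_prodMk_left)]
  refine lintegral_congr fun ξ => lintegral_congr fun y => ?_
  simp only [answers, Function.update_self]
  rw [A.answers_update G s ξ ⟨n, h⟩ y n (Nat.le_of_succ_le h) le_rfl]

/-- Chi-square comparison of the laws of the answers under two oracles. -/
theorem sq_lintegral_answers_le {G H : C → EuclideanSpace ℝ (Fin d)} (hG : Measurable G)
    (hH : Measurable H) {σ : ℝ} (hσ : 0 < σ) {K : ℝ} (hK : ∀ x, ‖H x - G x‖ ^ 2 / σ ^ 2 ≤ K)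
    (n : ℕ) (h : n ≤ T) {φ : A.Seed × (Fin n → EuclideanSpace ℝ (Fin d)) → ℝ≥0∞}
    (hφ : Measurable φ) :
    (∫⁻ p, φ (p.1, A.answers H p.1 p.2 n h) ∂(A.noiseLaw σ)) ^ 2 ≤
      ENNReal.ofReal (Real.exp K) ^ n *
        ∫⁻ p, φ (p.1, A.answers G p.1 p.2 n h) ^ 2 ∂(A.noiseLaw σ) := by
  induction n with
  | zero =>
    have := sq_lintegral_mul_le (A.noiseLaw σ) (f := fun p => φ (p.1, A.answers H p.1 p.2 0 h))
      (g := fun _ => 1)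
      (hφ.comp (measurable_fst.prodMk (A.measurable_answers hH 0 h))).aemeasurable
      aemeasurable_const
    simpa [answers] using this
  | succ n ih =>
    rw [A.lintegral_answers_succ hH σ n h hφ,
      A.lintegral_answers_succ hG σ n h (φ := fun q => φ q ^ 2) (hφ.pow_const 2)]
    have hmeas : ∀ {F : C → EuclideanSpace ℝ (Fin d)}, Measurable F →
        Measurable fun r : (A.Seed × (Fin n → EuclideanSpace ℝ (Fin d))) ×
          EuclideanSpace ℝ (Fin d) =>
          φ (r.1.1, Fin.snoc r.1.2 (F (A.query ⟨n, h⟩ r.1) + r.2)) := fun hF => by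
      refine hφ.comp ((measurable_fst.comp measurable_fst).prodMk
        ((measurable_snd.comp measurable_fst).finSnoc (Measurable.add ?_ measurable_snd)))
      exact hF.comp ((A.measurable_query _).comp measurable_fst)
    -- The induction hypothesis, applied to the conditional mean under `H`, switches the past to
    -- `G`; the last answer is then switched pointwise, its query point being the same for both
    -- oracles once the past is fixed.
    refine (ih (Nat.le_of_succ_le h) (hmeas hH).lintegral_prod_right').trans ?_
    rw [pow_succ, mul_assoc]
    refine mul_le_mul' le_rfl ?_
    rw [← lintegral_const_mul]
    beta_reduce
    · refine lintegral_mono fun p => ?_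
      have hsn : ∀ q : A.Seed × (Fin n → EuclideanSpace ℝ (Fin d)),
          Measurable fun z : EuclideanSpace ℝ (Fin d) => φ (q.1, Fin.snoc q.2 z) := fun q =>
        hφ.comp (measurable_const.prodMk (measurable_const.finSnoc measurable_id))
      refine (sq_lintegral_add_oracleNoise_le hσ (H (A.query ⟨n, h⟩
        (p.1, A.answers G p.1 p.2 n (Nat.le_of_succ_le h)))) (G (A.query ⟨n, h⟩
        (p.1, A.answers G p.1 p.2 n (Nat.le_of_succ_le h)))) (hsn (p.1, A.answers G p.1 p.2 n (Nat.le_of_succ_le h)))).trans ?_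
      gcongr
      exact hK _
    · exact ((hmeas hG).pow_const 2).lintegral_prod_right'.comp
        (measurable_fst.prodMk (A.measurable_answers hG n (Nat.le_of_succ_le h)))

end QueryAlgorithm

/-! ### Lower bound: two-point argument. -/

namespace LipConvex

variable {d : ℕ} {C : Set (EuclideanSpace ℝ (Fin d))}

theorem measurable_err (f : LipConvex C) : Measurable f.err :=
  (Metric.continuous_infEDist (s := f.argmin)).measurable

theorem argminDist_le_err_add_err (f g : LipConvex C) (x : C) :
    argminDist f g ≤ f.err x + g.err x := by
  simp only [err, ENNReal.iInf_add, ENNReal.add_iInf]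
  refine le_iInf₂ fun z hz => le_iInf₂ fun y hy => ?_
  exact (iInf₂_le_of_le y hy (iInf₂_le z hz)).trans (edist_triangle_left y z x)

end LipConvex

section LowerBound

variable {d : ℕ} {C : Set (EuclideanSpace ℝ (Fin d))}

theorem norm_grad_sub_le {O : SubgradientChoice C} {f g : LipConvex C} {ε : ℝ} (hε : 0 ≤ ε)
    (h : gradGap O f g ≤ ENNReal.ofReal ε) (x : C) : ‖O.grad f x - O.grad g x‖ ≤ ε := by
  have := (le_iSup (fun x : C => edist (O.grad f x) (O.grad g x)) x).trans h
  rwa [edist_dist, ENNReal.ofReal_le_ofReal_iff hε, dist_eq_norm] at this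

theorem argminDist_le_max_expectedErr (O : SubgradientChoice C) {σ : ℝ} (hσ : 0 < σ) {T : ℕ}
    (hT : 0 < T) {f g : LipConvex C}
    (hgap : gradGap O f g ≤ ENNReal.ofReal (σ / Real.sqrt T)) (A : QueryAlgorithm C T) :
    ENNReal.ofReal (1 / 32) * argminDist f g ≤ max (expectedErr O σ A f) (expectedErr O σ A g) := by
  have hTr : (0 : ℝ) < T := by exact_mod_cast hT
  set P := A.noiseLaw σ with hP
  set D := argminDist f g with hD
  let xf := fun p : A.Seed × (Fin T → EuclideanSpace ℝ (Fin d)) =>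
    (p.1, A.answers (O.grad f) p.1 p.2 T le_rfl)
  let xg := fun p : A.Seed × (Fin T → EuclideanSpace ℝ (Fin d)) =>
    (p.1, A.answers (O.grad g) p.1 p.2 T le_rfl)
  have hxf : Measurable xf :=
    measurable_fst.prodMk (A.measurable_answers (O.measurable_grad f) T le_rfl)
  have hxg : Measurable xg :=
    measurable_fst.prodMk (A.measurable_answers (O.measurable_grad g) T le_rfl)
  have hef := f.measurable_err.comp A.measurable_output
  have heg := g.measurable_err.comp A.measurable_output
  -- On `S` the output errs by at least `D / 2` for `f`, and off `S` for `g`.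
  set S : Set (A.Seed × (Fin T → EuclideanSpace ℝ (Fin d))) :=
    {q | g.err (A.output q) ≤ f.err (A.output q)} with hS
  have hSm : MeasurableSet S := measurableSet_le heg hef
  have hhalf : ∀ a b : ℝ≥0∞, D ≤ a + b → b ≤ a → D / 2 ≤ a := fun a b h hba => by
    refine ENNReal.div_le_of_le_mul ?_
    rw [mul_two]
    exact h.trans (by gcongr)
  have hmarkov : ∀ (U : Set (A.Seed × (Fin T → EuclideanSpace ℝ (Fin d)))) (h : LipConvex C)
      (x : A.Seed × (Fin T → EuclideanSpace ℝ (Fin d)) →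
        A.Seed × (Fin T → EuclideanSpace ℝ (Fin d))), MeasurableSet U → Measurable x →
      (∀ q ∈ U, D / 2 ≤ h.err (A.output q)) →
      D / 2 * P (x ⁻¹' U) ≤ ∫⁻ p, h.err (A.output (x p)) ∂P := fun U h x hU hx hle => by
    rw [← setLIntegral_const]
    refine (setLIntegral_mono' (hx hU) fun p hp => hle _ hp).trans (setLIntegral_le_lintegral _ _)
  have hEf : D / 2 * P (xf ⁻¹' S) ≤ expectedErr O σ A f :=
    hmarkov S f xf hSm hxf fun q hq =>
      hhalf _ _ (f.argminDist_le_err_add_err g _) hq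
  have hEg : D / 2 * P (xg ⁻¹' Sᶜ) ≤ expectedErr O σ A g :=
    hmarkov Sᶜ g xg hSm.compl hxg fun q hq =>
      hhalf _ _ ((f.argminDist_le_err_add_err g _).trans_eq (add_comm _ _)) (le_of_not_ge (Set.mem_compl_iff _ _ |>.1 hq))
  have hchi : P (xg ⁻¹' S) ^ 2 ≤ ENNReal.ofReal (Real.exp 1) * P (xf ⁻¹' S) := by
    have hK : ∀ x, ‖O.grad g x - O.grad f x‖ ^ 2 / σ ^ 2 ≤ 1 / (T : ℝ) := fun x => by
      have h1 := norm_grad_sub_le (by positivity) hgap x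
      rw [norm_sub_rev] at h1
      calc ‖O.grad g x - O.grad f x‖ ^ 2 / σ ^ 2 ≤ (σ / Real.sqrt T) ^ 2 / σ ^ 2 := by gcongr
        _ = 1 / (T : ℝ) := by
          rw [div_pow, Real.sq_sqrt hTr.le]
          field_simp
    have h := A.sq_lintegral_answers_le (O.measurable_grad f) (O.measurable_grad g) hσ hK T le_rfl
      (φ := S.indicator fun _ => 1) (measurable_const.indicator hSm)
    have hi : ∀ x : A.Seed × (Fin T → EuclideanSpace ℝ (Fin d)) →
        A.Seed × (Fin T → EuclideanSpace ℝ (Fin d)), Measurable x →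
        ∫⁻ p, S.indicator (fun _ => (1 : ℝ≥0∞)) (x p) ∂P = P (x ⁻¹' S) := fun x hx => by
      rw [← lintegral_indicator_one (hx hSm)]
      rfl
    have hsq : ∀ q, (S.indicator (fun _ => (1 : ℝ≥0∞)) q) ^ 2 = S.indicator (fun _ => 1) q := fun q => by
      by_cases hq : q ∈ S <;> simp [hq]
    simp_rw [hsq] at h
    rw [← ENNReal.ofReal_pow (by positivity), ← Real.exp_nat_mul, mul_one_div_cancel hTr.ne'] at h
    rw [← hi xg hxg, ← hi xf hxf]
    exact h
  have hc : ENNReal.ofReal (1 / 32) * D = D / 2 * ENNReal.ofReal (1 / 16) := by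
    have : (1 / 32 : ℝ) = 1 / 2 * (1 / 16) := by norm_num
    rw [this, ENNReal.ofReal_mul (by norm_num), mul_right_comm, ENNReal.div_eq_inv_mul]
    congr 2
    rw [one_div, ENNReal.ofReal_inv_of_pos two_pos]
    simp
  rw [hc]
  -- If the `g`-law gives `Sᶜ` less than `1 / 2`, it gives `S` more than `1 / 2`, so by `hchi` the
  -- `f`-law gives `S` at least `1 / (4 * e) ≥ 1 / 16`.
  by_cases hg2 : ENNReal.ofReal (1 / 2) ≤ P (xg ⁻¹' Sᶜ)
  · refine le_trans ?_ (hEg.trans (le_max_right _ _))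
    gcongr
    exact (ENNReal.ofReal_le_ofReal (by norm_num)).trans hg2
  · refine le_trans ?_ (hEf.trans (le_max_left _ _))
    gcongr
    have hcompl : P.real (xg ⁻¹' Sᶜ) = 1 - P.real (xg ⁻¹' S) := by
      rw [Set.preimage_compl, probReal_compl_eq_one_sub (hxg hSm)]
    rw [← ofReal_measureReal, ENNReal.ofReal_le_ofReal_iff measureReal_nonneg, not_le,
      hcompl] at hg2
    rw [← ofReal_measureReal (s := xg ⁻¹' S), ← ofReal_measureReal (s := xf ⁻¹' S),
      ← ENNReal.ofReal_pow measureReal_nonneg, ← ENNReal.ofReal_mul (by positivity),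
      ENNReal.ofReal_le_ofReal_iff (by positivity)] at hchi
    rw [← ofReal_measureReal (s := xf ⁻¹' S)]
    refine ENNReal.ofReal_le_ofReal ?_
    have he : Real.exp 1 ≤ 4 := by linarith [Real.exp_one_lt_d9]
    have hp : 0 ≤ P.real (xf ⁻¹' S) := measureReal_nonneg
    nlinarith

theorem modulus_le_localMinimax (O : SubgradientChoice C) {σ : ℝ} (hσ : 0 < σ) {T : ℕ}
    (hT : 0 < T) (f : LipConvex C) :
    ENNReal.ofReal (1 / 32) * modulus O f (σ / Real.sqrt T) ≤ localMinimax O σ T f := by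
  simp only [modulus, ENNReal.mul_iSup]
  refine iSup₂_le fun g hg => ?_
  exact le_iSup_of_le g (le_iInf fun A => argminDist_le_max_expectedErr O hσ hT hg A)

end LowerBound

/-! ### Upper bound: likelihood ratio test at one point. -/

theorem hasSubgaussianMGF_id_gaussianReal (v : ℝ≥0) : HasSubgaussianMGF id v (gaussianReal 0 v) where
  integrable_exp_mul t := integrable_exp_mul_gaussianReal t
  mgf_le t := by simp [mgf_id_gaussianReal]

theorem map_inner_oracleNoise {d : ℕ} (σ : ℝ) (m : EuclideanSpace ℝ (Fin d)) :
    (oracleNoise d σ).map (fun z => inner ℝ m z) =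
      gaussianReal 0 (σ ^ 2 * ‖m‖ ^ 2).toNNReal := by
  rw [oracleNoise, Measure.map_map (by fun_prop) (by fun_prop)]
  have h : ((fun z : EuclideanSpace ℝ (Fin d) => inner ℝ m z) ∘ fun z => σ • z) =
      fun z => inner ℝ (σ • m) z := by
    ext z
    simp [real_inner_smul_left, real_inner_smul_right]
  rw [h, map_inner_stdGaussian, norm_smul, mul_pow, Real.norm_eq_abs, sq_abs]

/-- Chernoff bound for a sum with variance proxy `T * σ ^ 2 * ‖m‖ ^ 2`; the threshold is the
midpoint between the means of the test statistic under the two hypotheses. -/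
theorem pi_oracleNoise_sum_inner_ge_le {d : ℕ} (σ : ℝ) (T : ℕ) (m : EuclideanSpace ℝ (Fin d)) :
    (Measure.pi fun _ : Fin T => oracleNoise d σ)
      {ξ | (T : ℝ) * ‖m‖ ^ 2 / 2 ≤ ∑ t, inner ℝ m (ξ t)} ≤
      ENNReal.ofReal (Real.exp (-(T * ‖m‖ ^ 2 / (8 * σ ^ 2)))) := by
  have hind : iIndepFun (fun (t : Fin T) (ξ : Fin T → EuclideanSpace ℝ (Fin d)) => inner ℝ m (ξ t))
      (Measure.pi fun _ : Fin T => oracleNoise d σ) :=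
    iIndepFun_pi (X := fun _ z => inner ℝ m z)
      (fun _ => (Measurable.inner measurable_const measurable_id).aemeasurable)
  have hsub : ∀ t ∈ Finset.univ, HasSubgaussianMGF
      (fun ξ : Fin T → EuclideanSpace ℝ (Fin d) => inner ℝ m (ξ t))
      (σ ^ 2 * ‖m‖ ^ 2).toNNReal (Measure.pi fun _ : Fin T => oracleNoise d σ) := fun t _ => by
    refine HasSubgaussianMGF.of_map (X := id) (Y := fun ξ : Fin T → EuclideanSpace ℝ (Fin d) =>
      inner ℝ m (ξ t)) (Measurable.inner measurable_const (measurable_pi_apply t)).aemeasurable ?_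
    have h : (Measure.pi fun _ : Fin T => oracleNoise d σ).map (fun ξ => inner ℝ m (ξ t)) =
        gaussianReal 0 (σ ^ 2 * ‖m‖ ^ 2).toNNReal := by
      have he := (measurePreserving_eval (fun _ : Fin T => oracleNoise d σ) t).map_eq
      rw [← map_inner_oracleNoise]
      conv_rhs => rw [← he]
      exact (Measure.map_map (Measurable.inner measurable_const measurable_id)
        (measurable_pi_apply t)).symm
    rw [h]
    exact hasSubgaussianMGF_id_gaussianReal _
  have hT := HasSubgaussianMGF.measure_sum_ge_le_of_iIndepFun hind hsub
    (ε := T * ‖m‖ ^ 2 / 2) (by positivity)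
  rw [← ofReal_measureReal]
  refine ENNReal.ofReal_le_ofReal (hT.trans_eq ?_)
  congr 1
  simp only [Finset.sum_const, Finset.card_univ, Fintype.card_fin, nsmul_eq_mul, NNReal.coe_mul,
    NNReal.coe_natCast, Real.coe_toNNReal _ (show 0 ≤ σ ^ 2 * ‖m‖ ^ 2 by positivity)]
  -- In the degenerate cases both exponents are `0`, as division by zero gives `0`.
  rcases eq_or_ne m 0 with rfl | hm
  · simp
  rcases eq_or_ne σ 0 with rfl | hσ
  · simp
  rcases Nat.eq_zero_or_pos T with rfl | hTp
  · simp
  have : ‖m‖ ≠ 0 := norm_ne_zero_iff.2 hm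
  field_simp
  ring

section UpperBound

variable {d : ℕ} {C : Set (EuclideanSpace ℝ (Fin d))}

theorem QueryAlgorithm.answers_of_query_const {T : ℕ} (A : QueryAlgorithm C T) {x : C}
    (hA : ∀ t q, A.query t q = x) (G : C → EuclideanSpace ℝ (Fin d)) (s : A.Seed)
    (ξ : Fin T → EuclideanSpace ℝ (Fin d)) (n : ℕ) (h : n ≤ T) :
    A.answers G s ξ n h = fun t => G x + ξ (Fin.castLE h t) := by
  induction n with
  | zero => exact Subsingleton.elim _ _
  | succ n ih =>
    funext t
    simp only [answers, ih (Nat.le_of_succ_le h), hA]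
    refine Fin.lastCases ?_ (fun j => ?_) t
    · rw [Fin.snoc_last]; rfl
    · rw [Fin.snoc_castSucc]; rfl

open Classical in
/-- The algorithm that always queries `x` and outputs `y` or `z` according to whether the
likelihood ratio test prefers the mean `a` or the mean `a + m` for the answers. -/
noncomputable def testAlgorithm (T : ℕ) (x y z : C) (a m : EuclideanSpace ℝ (Fin d)) :
    QueryAlgorithm C T where
  Seed := Unit
  seedMeasurableSpace := inferInstance
  seedLaw := Measure.dirac ()
  seedLaw_prob := inferInstance
  query _ _ := x
  measurable_query _ := measurable_const
  output q := if (T : ℝ) * ‖m‖ ^ 2 / 2 ≤ ∑ t, inner ℝ m (q.2 t - a) then z else y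
  measurable_output := by
    refine Measurable.ite (measurableSet_le measurable_const ?_) measurable_const measurable_const
    fun_prop

theorem LipConvex.err_eq_zero {f : LipConvex C} {x : C} (hx : x ∈ f.argmin) : f.err x = 0 :=
  le_antisymm ((iInf₂_le x hx).trans_eq (edist_self x)) zero_le

theorem lintegral_ite_le {Ω : Type*} [MeasurableSpace Ω] (P : Measure Ω) {S : Set Ω}
    (hS : MeasurableSet S) {F : Ω → ℝ≥0∞} {c : ℝ≥0∞} (h1 : ∀ ω ∈ S, F ω ≤ c)
    (h0 : ∀ ω ∉ S, F ω = 0) : ∫⁻ ω, F ω ∂P ≤ c * P S := by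
  rw [← lintegral_indicator_const hS]
  refine lintegral_mono fun ω => ?_
  by_cases h : ω ∈ S
  · simpa [h] using h1 ω h
  · simp [h, h0 ω h]

theorem expectedErr_testAlgorithm_le (O : SubgradientChoice C) (σ : ℝ) (T : ℕ)
    {f g : LipConvex C} {y z : C} (hy : y ∈ f.argmin) (hz : z ∈ g.argmin) (x : C) :
    max (expectedErr O σ (testAlgorithm T x y z (O.grad f x) (O.grad g x - O.grad f x)) f)
      (expectedErr O σ (testAlgorithm T x y z (O.grad f x) (O.grad g x - O.grad f x)) g) ≤
      edist y z *
        ENNReal.ofReal (Real.exp (-(T * ‖O.grad g x - O.grad f x‖ ^ 2 / (8 * σ ^ 2)))) := by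
  set m := O.grad g x - O.grad f x with hm
  set A := testAlgorithm T x y z (O.grad f x) m with hA
  have hans : ∀ G s ξ, A.answers G s ξ T le_rfl = fun t => G x + ξ t := fun G s ξ =>
    A.answers_of_query_const (fun _ _ => rfl) G s ξ T le_rfl
  have htail : ∀ m' : EuclideanSpace ℝ (Fin d), ‖m'‖ = ‖m‖ →
      MeasurableSet {ξ : Fin T → EuclideanSpace ℝ (Fin d) |
        (T : ℝ) * ‖m'‖ ^ 2 / 2 ≤ ∑ t, inner ℝ m' (ξ t)} ∧
      (A.seedLaw.prod (Measure.pi fun _ : Fin T => oracleNoise d σ)) (Set.univ ×ˢ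
        {ξ | (T : ℝ) * ‖m'‖ ^ 2 / 2 ≤ ∑ t, inner ℝ m' (ξ t)}) ≤
      ENNReal.ofReal (Real.exp (-(T * ‖m‖ ^ 2 / (8 * σ ^ 2)))) := fun m' h => by
    refine ⟨measurableSet_le measurable_const (by fun_prop), ?_⟩
    rw [Measure.prod_prod, measure_univ, one_mul, ← h]
    exact pi_oracleNoise_sum_inner_ge_le σ T m'
  refine max_le ?_ ?_
  · obtain ⟨hS, htl⟩ := htail m rfl
    refine (lintegral_ite_le _ (MeasurableSet.univ.prod hS) (c := edist y z) ?_ ?_).trans (by gcongr)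
    · rintro ⟨s, ξ⟩ ⟨-, hξ⟩
      change (T : ℝ) * ‖m‖ ^ 2 / 2 ≤ ∑ t, inner ℝ m (ξ t) at hξ
      simp only [hans]
      simp only [A, testAlgorithm, add_sub_cancel_left]
      rw [if_pos hξ, edist_comm]
      exact iInf₂_le y hy
    · rintro ⟨s, ξ⟩ hξ
      replace hξ : ¬ (T : ℝ) * ‖m‖ ^ 2 / 2 ≤ ∑ t, inner ℝ m (ξ t) := fun h => hξ ⟨trivial, h⟩
      simp only [hans]
      simp only [A, testAlgorithm, add_sub_cancel_left]
      rw [if_neg hξ]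
      exact LipConvex.err_eq_zero hy
  -- Under `g` the statistic is `T * ‖m‖ ^ 2` plus noise, so missing the threshold is a tail event
  -- for `-m`.
  · obtain ⟨hS, htl⟩ := htail (-m) (norm_neg m)
    refine (lintegral_ite_le _ (MeasurableSet.univ.prod hS) (c := edist y z) ?_ ?_).trans (by gcongr)
    · rintro ⟨s, ξ⟩ -
      simp only [A, testAlgorithm]
      split_ifs
      · rw [LipConvex.err_eq_zero hz]; exact zero_le
      · exact iInf₂_le z hz
    · rintro ⟨s, ξ⟩ hξ
      simp only [hans]
      simp only [A, testAlgorithm]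
      rw [if_pos]
      · exact LipConvex.err_eq_zero hz
      · have h : ¬ (T : ℝ) * ‖-m‖ ^ 2 / 2 ≤ ∑ t, inner ℝ (-m) (ξ t) := fun h => hξ ⟨trivial, h⟩
        have h2 : ∀ t, inner ℝ m (O.grad g x + ξ t - O.grad f x) = ‖m‖ ^ 2 - inner ℝ (-m) (ξ t) := by
          intro t
          rw [add_sub_right_comm, ← hm, inner_add_right, real_inner_self_eq_norm_sq, inner_neg_left,
            sub_neg_eq_add]
        simp_rw [h2]
        rw [Finset.sum_sub_distrib]
        rw [norm_neg] at h
        simp only [Finset.sum_const, Finset.card_univ, Fintype.card_fin, nsmul_eq_mul]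
        linarith

theorem LipConvex.continuous (f : LipConvex C) : Continuous f.toFun :=
  f.lipschitz.choose_spec.continuous

theorem LipConvex.nonempty_argmin [CompactSpace C] [Nonempty C] (f : LipConvex C) :
    f.argmin.Nonempty := by
  obtain ⟨x, -, hx⟩ := isCompact_univ.exists_isMinOn Set.univ_nonempty f.continuous.continuousOn
  exact ⟨x, fun y => hx (Set.mem_univ y)⟩

theorem LipConvex.isClosed_argmin (f : LipConvex C) : IsClosed f.argmin := by
  simp only [argmin, Set.ofPred_forall]
  exact isClosed_iInter fun y => isClosed_le f.continuous continuous_const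

theorem exists_edist_eq_argminDist [CompactSpace C] [Nonempty C] (f g : LipConvex C) :
    ∃ y ∈ f.argmin, ∃ z ∈ g.argmin, edist y z ≤ argminDist f g := by
  have hc : ContinuousOn (fun p : C × C => edist p.1 p.2) (f.argmin ×ˢ g.argmin) :=
    (continuous_fst.edist continuous_snd).continuousOn
  obtain ⟨p, hp, hmin⟩ :=
    (f.isClosed_argmin.isCompact.prod g.isClosed_argmin.isCompact).exists_isMinOn
      (f.nonempty_argmin.prod g.nonempty_argmin) hc
  refine ⟨p.1, hp.1, p.2, hp.2, le_iInf₂ fun y hy => le_iInf₂ fun z hz => ?_⟩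
  exact isMinOn_iff.1 hmin (y, z) (Set.mk_mem_prod hy hz)

theorem iInf_max_expectedErr_le [CompactSpace C] (O : SubgradientChoice C) (σ : ℝ)
    (T : ℕ) (f g : LipConvex C) (x : C) :
    ⨅ A : QueryAlgorithm C T, max (expectedErr O σ A f) (expectedErr O σ A g) ≤
      argminDist f g *
        ENNReal.ofReal (Real.exp (-(T * ‖O.grad g x - O.grad f x‖ ^ 2 / (8 * σ ^ 2)))) := by
  have : Nonempty C := ⟨x⟩
  obtain ⟨y, hy, z, hz, h⟩ := exists_edist_eq_argminDist f g
  exact (iInf_le _ _).trans ((expectedErr_testAlgorithm_le O σ T hy hz x).trans (by gcongr))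

/-! ### Upper bound: trading polynomial growth against the Gaussian tail. -/

theorem argminDist_le_modulus (O : SubgradientChoice C) {f g : LipConvex C} {ε : ℝ}
    (h : gradGap O f g ≤ ENNReal.ofReal ε) : argminDist f g ≤ modulus O f ε :=
  le_iSup₂_of_le g h le_rfl

theorem argminDist_le_ediam [CompactSpace C] [Nonempty C] (f g : LipConvex C) :
    argminDist f g ≤ Metric.ediam (Set.univ : Set C) := by
  obtain ⟨y, hy⟩ := f.nonempty_argmin
  obtain ⟨z, hz⟩ := g.nonempty_argmin
  exact (iInf₂_le_of_le y hy (iInf₂_le z hz)).trans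
    (Metric.edist_le_ediam_of_mem (Set.mem_univ y) (Set.mem_univ z))

/-- Combines `t ^ α ≤ (t ^ 2) ^ n` with `s ^ n / n! ≤ exp s` at `s = t ^ 2 / 32`. -/
theorem rpow_mul_exp_neg_sq_le {α : ℝ} {n : ℕ} (hn : α ≤ n) {t : ℝ} (ht : 1 ≤ t) :
    t ^ α * Real.exp (-(t ^ 2 / 32)) ≤ 32 ^ n * n.factorial := by
  have h0 : 0 < t := by linarith
  have h1 : t ^ α ≤ (t ^ 2) ^ n := by
    rw [← pow_mul, ← Real.rpow_natCast]
    refine Real.rpow_le_rpow_of_exponent_le ht ?_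
    push_cast
    have : (0 : ℝ) ≤ n := by positivity
    linarith
  have h2 := Real.pow_div_factorial_le_exp (x := t ^ 2 / 32) (by positivity) n
  rw [div_pow, div_div, div_le_iff₀ (by positivity)] at h2
  rw [Real.exp_neg, ← div_eq_mul_inv, div_le_iff₀ (by positivity)]
  linarith

/-- Here `k` stands for the gap truncated at `ε₀`. Beyond `ε₀` growth says nothing, but `d(f, g)` is
at most the diameter, a finite multiple of `ω_f(ε₀)` because `ω_f(ε₀) > 0`. -/
theorem argminDist_le_of_polynomialGrowth [CompactSpace C] [Nonempty C] {O : SubgradientChoice C}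
    {f : LipConvex C} {α ε₀ : ℝ} (hε₀ : 0 < ε₀)
    (hgrowth : ∀ c ε : ℝ, 1 ≤ c → 0 < ε → ε ≤ ε₀ / c →
      modulus O f (c * ε) ≤ ENNReal.ofReal (c ^ α) * modulus O f ε)
    (hpos : 0 < modulus O f ε₀) (g : LipConvex C) {ε k : ℝ} (hε : 0 < ε) (hεk : ε ≤ k)
    (hk : k ≤ ε₀) (hgap : gradGap O f g ≤ ENNReal.ofReal k ∨ k = ε₀) :
    argminDist f g ≤ ENNReal.ofReal
      ((1 + (Metric.ediam (Set.univ : Set C) / modulus O f ε₀).toReal) * (k / ε) ^ α) *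
        modulus O f ε := by
  have hk0 : 0 < k := hε.trans_le hεk
  have hg := hgrowth (k / ε) ε ((one_le_div hε).2 hεk) hε (by
    rw [le_div_iff₀ (by positivity)]
    field_simp
    exact hk)
  rw [div_mul_cancel₀ _ hε.ne'] at hg
  rw [ENNReal.ofReal_mul (by positivity), mul_assoc]
  have hfin : Metric.ediam (Set.univ : Set C) / modulus O f ε₀ ≠ ∞ :=
    ENNReal.div_ne_top (isCompact_univ.isBounded.ediam_ne_top) hpos.ne'
  rw [ENNReal.ofReal_add zero_le_one ENNReal.toReal_nonneg, ENNReal.ofReal_toReal hfin,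
    ENNReal.ofReal_one]
  rcases hgap with h | rfl
  · exact (argminDist_le_modulus O h).trans (hg.trans (le_mul_of_one_le_left' le_self_add))
  · have hle : modulus O f k ≤ Metric.ediam (Set.univ : Set C) :=
      iSup₂_le fun g _ => argminDist_le_ediam f g
    have htop : modulus O f k ≠ ∞ :=
      ne_top_of_le_ne_top (isCompact_univ.isBounded.ediam_ne_top) hle
    calc argminDist f g ≤ Metric.ediam (Set.univ : Set C) := argminDist_le_ediam f g
      _ = Metric.ediam (Set.univ : Set C) / modulus O f k * modulus O f k :=
        (ENNReal.div_mul_cancel hpos.ne' htop).symm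
      _ ≤ _ := by
        gcongr
        exact le_add_self

theorem localMinimax_le_modulus [CompactSpace C] [Nonempty C] (O : SubgradientChoice C) {σ : ℝ}
    (hσ : 0 < σ) {f : LipConvex C} {α ε₀ : ℝ} (hε₀ : 0 < ε₀)
    (hgrowth : ∀ c ε : ℝ, 1 ≤ c → 0 < ε → ε ≤ ε₀ / c →
      modulus O f (c * ε) ≤ ENNReal.ofReal (c ^ α) * modulus O f ε)
    (hpos : 0 < modulus O f ε₀) {n : ℕ} (hn : α ≤ n) {T : ℕ} (hT : 0 < T)
    (hTε : σ / Real.sqrt T ≤ ε₀) :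
    localMinimax O σ T f ≤ ENNReal.ofReal
      ((1 + (Metric.ediam (Set.univ : Set C) / modulus O f ε₀).toReal) * (32 ^ n * n.factorial)) *
        modulus O f (σ / Real.sqrt T) := by
  have hTr : (0 : ℝ) < T := by exact_mod_cast hT
  set ε := σ / Real.sqrt T with hεdef
  have hε : 0 < ε := by positivity
  set M := 1 + (Metric.ediam (Set.univ : Set C) / modulus O f ε₀).toReal with hM
  have hM1 : 1 ≤ M := le_add_of_nonneg_right ENNReal.toReal_nonneg
  have hfac : (1 : ℝ) ≤ 32 ^ n * n.factorial :=
    one_le_mul_of_one_le_of_one_le (one_le_pow₀ (by norm_num)) (by exact_mod_cast n.factorial_pos)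
  refine iSup_le fun g => ?_
  rcases le_or_gt (gradGap O f g) (ENNReal.ofReal ε) with hsmall | hlarge
  · refine (iInf_max_expectedErr_le O σ T f g (Classical.arbitrary C)).trans ?_
    calc _ ≤ argminDist f g * 1 := by
          gcongr
          rw [ENNReal.ofReal_le_one, Real.exp_le_one_iff, neg_nonpos]
          positivity
      _ ≤ 1 * modulus O f ε := by
          rw [mul_one, one_mul]
          exact argminDist_le_modulus O hsmall
      _ ≤ _ := by
          gcongr
          rw [ENNReal.one_le_ofReal]
          exact one_le_mul_of_one_le_of_one_le hM1 hfac
  · obtain ⟨k, hεk, hk, hkgap, hdich⟩ : ∃ k : ℝ, ε ≤ k ∧ k ≤ ε₀ ∧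
        ENNReal.ofReal k ≤ gradGap O f g ∧ (gradGap O f g ≤ ENNReal.ofReal k ∨ k = ε₀) := by
      rcases le_or_gt (gradGap O f g) (ENNReal.ofReal ε₀) with h | h
      · have hne : gradGap O f g ≠ ∞ := ne_top_of_le_ne_top ENNReal.ofReal_ne_top h
        refine ⟨(gradGap O f g).toReal, ?_, ENNReal.toReal_le_of_le_ofReal hε₀.le h,
          ENNReal.ofReal_toReal_le, Or.inl (ENNReal.ofReal_toReal hne).ge⟩
        exact (ENNReal.ofReal_le_iff_le_toReal hne).1 hlarge.le
      · exact ⟨ε₀, hTε, le_rfl, h.le, Or.inr rfl⟩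
    have hk0 : 0 < k := hε.trans_le hεk
    -- The supremum need not be attained; settling for `k / 2` turns the `8` of the tail bound into
    -- `32`.
    obtain ⟨x, hx⟩ : ∃ x : C, k / 2 < ‖O.grad g x - O.grad f x‖ := by
      have h : ENNReal.ofReal (k / 2) < gradGap O f g :=
        ((ENNReal.ofReal_lt_ofReal_iff hk0).2 (by linarith)).trans_le hkgap
      obtain ⟨x, hx⟩ := lt_iSup_iff.1 h
      refine ⟨x, ?_⟩
      rw [edist_dist, ENNReal.ofReal_lt_ofReal_iff_of_nonneg (by positivity), dist_comm,
        dist_eq_norm] at hx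
      exact hx
    refine (iInf_max_expectedErr_le O σ T f g x).trans ?_
    have hd := argminDist_le_of_polynomialGrowth hε₀ hgrowth hpos g hε hεk hk hdich
    have hexp : Real.exp (-(T * ‖O.grad g x - O.grad f x‖ ^ 2 / (8 * σ ^ 2))) ≤
        Real.exp (-((k / ε) ^ 2 / 32)) := by
      refine Real.exp_le_exp.2 (neg_le_neg ?_)
      calc (k / ε) ^ 2 / 32 = T * (k / 2) ^ 2 / (8 * σ ^ 2) := by
            rw [hεdef, div_div_eq_mul_div, div_pow, mul_pow, Real.sq_sqrt hTr.le]
            field_simp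
            norm_num
        _ ≤ _ := by gcongr
    calc _ ≤ ENNReal.ofReal (M * (k / ε) ^ α) * modulus O f ε *
          ENNReal.ofReal (Real.exp (-((k / ε) ^ 2 / 32))) := by gcongr
      _ = ENNReal.ofReal (M * ((k / ε) ^ α * Real.exp (-((k / ε) ^ 2 / 32)))) * modulus O f ε := by
          rw [mul_right_comm, ← ENNReal.ofReal_mul (by positivity), mul_assoc]
      _ ≤ _ := by
          refine mul_le_mul' (ENNReal.ofReal_le_ofReal (mul_le_mul_of_nonneg_left ?_
            (zero_le_one.trans hM1))) le_rfl
          exact rpow_mul_exp_neg_sq_le hn ((one_le_div hε).2 hεk)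

end UpperBound

theorem theorem1 {d : ℕ} (C : Set (EuclideanSpace ℝ (Fin d)))
    (hCne : C.Nonempty) (hCcompact : IsCompact C) (hCconvex : Convex ℝ C)
    (O : SubgradientChoice C) (σ : ℝ) (hσ : 0 < σ) (f : LipConvex C)
    (hgrowth : PolynomialGrowth (modulus O f))
    (hpos : ∀ ε : ℝ, 0 < ε → 0 < modulus O f ε) :
    ∃ C₁ C₂ T₀ : ℝ, 0 < C₁ ∧ 0 < C₂ ∧ 0 < T₀ ∧ ∀ T : ℕ, T₀ < (T : ℝ) →
      ENNReal.ofReal C₁ * modulus O f (σ / Real.sqrt T) ≤ localMinimax O σ T f ∧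
      localMinimax O σ T f ≤ ENNReal.ofReal C₂ * modulus O f (σ / Real.sqrt T) := by
  obtain ⟨α, ε₀, -, hε₀, hgr⟩ := hgrowth
  have : CompactSpace C := isCompact_iff_compactSpace.1 hCcompact
  have : Nonempty C := hCne.to_subtype
  -- `T > (σ / ε₀) ^ 2` ensures `σ / √T ≤ ε₀`, the range where growth applies.
  refine ⟨1 / 32, (1 + (Metric.ediam (Set.univ : Set C) / modulus O f ε₀).toReal) *
    (32 ^ ⌈α⌉₊ * ⌈α⌉₊.factorial), (σ / ε₀) ^ 2, by norm_num, by positivity, by positivity,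
    fun T hT => ?_⟩
  have hTr : (0 : ℝ) < T := lt_of_le_of_lt (by positivity) hT
  have hT0 : 0 < T := by exact_mod_cast hTr
  refine ⟨modulus_le_localMinimax O hσ hT0 f, localMinimax_le_modulus O hσ hε₀ hgr
    (hpos ε₀ hε₀) (Nat.le_ceil α) hT0 ?_⟩
  rw [div_le_comm₀ (Real.sqrt_pos.2 hTr) hε₀]
  exact Real.le_sqrt_of_sq_le hT.le
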